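/- Let $0\le q\le r\le m$ be integers. Index $2^m$ qubits by $\mathbb{Z}_2^m$, let $S=\{1,\dots,m\}$, and for $J\subseteq S$ let $\langle J\rangle\subseteq\mathbb{Z}_2^m$ be the set of bit strings supported in $J$; a $d$-cube is a coset $x+\langle J\rangle$ with $|J|=d$. For a single-qubit gate $U$ and $A\subseteq\mathbb{Z}_2^m$ let $U_A$ act as $U$ on each qubit in $A$ and as the identity elsewhere. The code $QRM_m(q,r)$ is the common $+1$ eigenspace of the operators $X_A$ ($A$ an $(m-q)$-cube) and $Z_A$ ($A$ an $(r+1)$-cube). Two operators are logically equivalent on a code, written $U\equiv V$, if $U|\psi\rangle=V|\psi\rangle$ for all code states $|\psi\rangle$. For $k\ge 0$ let $Z(k)=|0\rangle\langle 0|+e^{i\pi/2^k}|1\rangle\langle 1|$, and let $\widetilde{Z}(k)_A$ act as $Z(k)$ on the qubits in $A$ of even Hamming weight, as $Z(k)^\dagger$ on the qubits in $A$ of odd Hamming weight, and as the identity elsewhere. The logical qubits of $QRM_m(q,r)$ are indexed by $\mathcal{Q}=\{J\subseteq S: q+1\le|J|\le r\}$, the $J$-th one having logical Pauli operators $\overline{Z}_J=Z_{\langle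 J\rangle}$ and $\overline{X}_J=X_{e_J+\langle S\setminus J\rangle}$, where $e_J$ is the indicator vector of $J$. For nonempty $\mathcal{J}\subseteq\mathcal{Q}$ let $\overline{C^{\mathcal{J}}Z}=I-2\prod_{J\in\mathcal{J}}\tfrac12(I-\overline{Z}_J)$ be the logical multi-controlled-$Z$ gate on the logical qubits in $\mathcal{J}$, let $\overline{C^{\emptyset}Z}=I$, and for a collection $\mathcal{F}$ of subsets of $\mathcal{Q}$ let $\overline{C^{\mathcal{F}}Z}=\prod_{\mathcal{J}\in\mathcal{F}}\overline{C^{\mathcal{J}}Z}$. Let $\mathcal{Q}_k=\{K\subseteq S: q+kr+1\le|K|\le(k+1)r\}$ for $k\geq 0$; these collections are pairwise disjoint. For $K\in\mathcal{Q}_k$ let $\mathcal{F}(K)$ be the collection of all $\mathcal{J}\subseteq\mathcal{Q}$ with $|\mathcal{J}|=k+1$ and $\bigcup_{J\in\mathcal{J}}J=K$; if $K$ is in no $\mathcal{Q}_k$, let $\mathcal{F}(K)=\emptyset$, so that $\overline{C^{\mathcal{F}(K)}Z}=I$. Lemma. Let $k\ge 0$ and $K\subseteq S$. (1) If $2\le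 r\le m$ and $|K|=kr+1$, then on $QRM_m(0,r)$ $$Z(k)_{\langle K\rangle}\equiv\overline{C^{\mathcal{F}(K)}Z}\cdot\prod_{i\in K}\overline{C^{\mathcal{F}(K\setminus\{i\})}Z}.$$ (2) Let $0\le q\le r\le m$ and $K\in\mathcal{Q}_k$. If $Z(k)_{\langle K\rangle}$ and $\widetilde{Z}(k)_{\langle K\rangle}$ are not logically equivalent on $QRM_m(q,r)$, then $q=0$ and $|K|=kr+1$. -/

import Mathlib

open scoped Matrix

noncomputable section

namespace QRM

/-! ### The hypercube and its subcubes -/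

/-- The vertices of the `m`-dimensional hypercube: bit strings of length `m` under bitwise addition.
The set `S` of standard generators is identified with `Fin m`. -/
abbrev Cube (m : ℕ) := Fin m → ZMod 2

/-- The standard subcube generated by `J`: the bit strings supported inside `J`. -/
def standardCube {m : ℕ} (J : Finset (Fin m)) : Set (Cube m) :=
  {y | ∀ i, i ∉ J → y i = 0}

/-- The subcube `x + ⟨J⟩`, the coset of the standard subcube of `J` through `x`;
its dimension is `J.card`. -/
def subcube {m : ℕ} (x : Cube m) (J : Finset (Fin m)) : Set (Cube m) :=
  {y | y - x ∈ standardCube J}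

/-! ### Operators on `2 ^ m` qubits, one qubit for each vertex of the hypercube -/

/-- Labels of the computational basis states: one bit for each vertex. -/
abbrev Config (m : ℕ) := Cube m → ZMod 2

/-- State vectors, written in the computational basis. -/
abbrev State (m : ℕ) := Config m → ℂ

/-- Operators on the state space, as matrices in the computational basis. -/
abbrev Op (m : ℕ) := Matrix (Config m) (Config m) ℂ

/-- Single-qubit operators. -/
abbrev Gate := Matrix (ZMod 2) (ZMod 2) ℂ

/-- The transversal operator `⨂ₓ U x`. -/
def tensorOp {m : ℕ} (U : Cube m → Gate) : Op m :=
  Matrix.of fun a b => ∏ x, U x (a x) (b x)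

/-- The Pauli operator `X`. -/
def pauliX : Gate := Matrix.of fun a b => if a = b + 1 then 1 else 0

/-- The gate `Z(k) = |0⟩⟨0| + exp (i π / 2 ^ k) |1⟩⟨1|`. -/
def zGate (k : ℕ) : Gate :=
  Matrix.diagonal fun a => if a = 0 then 1 else Complex.exp (Complex.I * Real.pi / 2 ^ k)

/-- The Pauli operator `Z`. -/
def pauliZ : Gate := Matrix.diagonal fun a => if a = 0 then 1 else -1

open scoped Classical in
/-- `U_A`: the gate `U` on the qubits in `A` and the identity elsewhere. -/
def subcubeOp {m : ℕ} (U : Gate) (A : Set (Cube m)) : Op m :=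
  tensorOp fun x => if x ∈ A then U else 1

open scoped Classical in
/-- The signed operator: `Z(k)` on the vertices of `A` of even Hamming weight, its adjoint on the
vertices of `A` of odd Hamming weight, and the identity elsewhere. -/
def signedOp {m : ℕ} (k : ℕ) (A : Set (Cube m)) : Op m :=
  tensorOp fun x =>
    if x ∈ A then (if Even (hammingNorm x) then zGate k else (zGate k)ᴴ) else 1

/-! ### Quantum Reed--Muller codes -/

/-- The code space of `QRM_m(q, r)`, where `q ≤ r ≤ m`: the common `+1` eigenspace of the operators
`X_A` for the `(m - q)`-cubes `A` and `Z_A` for the `(r + 1)`-cubes `A`. -/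
def code (m q r : ℕ) : Submodule ℂ (State m) where
  carrier := {ψ |
    (∀ (x : Cube m) (J : Finset (Fin m)), J.card = m - q →
      subcubeOp pauliX (subcube x J) *ᵥ ψ = ψ) ∧
    (∀ (x : Cube m) (J : Finset (Fin m)), J.card = r + 1 →
      subcubeOp pauliZ (subcube x J) *ᵥ ψ = ψ)}
  zero_mem' := by
    constructor <;> intros <;> exact Matrix.mulVec_zero _
  add_mem' := by
    rintro a b ⟨ha, ha'⟩ ⟨hb, hb'⟩
    constructor
    · intro x J h
      rw [Matrix.mulVec_add, ha x J h, hb x J h]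
    · intro x J h
      rw [Matrix.mulVec_add, ha' x J h, hb' x J h]
  smul_mem' := by
    rintro c a ⟨ha, ha'⟩
    constructor
    · intro x J h
      rw [Matrix.mulVec_smul, ha x J h]
    · intro x J h
      rw [Matrix.mulVec_smul, ha' x J h]

/-- Two operators are logically equivalent on a code if they act in the same way on every
code state (exactly, not only up to a global phase). -/
def LogicallyEquiv {m : ℕ} (C : Submodule ℂ (State m)) (U V : Op m) : Prop :=
  ∀ ψ ∈ C, U *ᵥ ψ = V *ᵥ ψ

/-! ### Logical index sets and minimal covers -/

/-- The index set `𝒬_k` of the `k`-th level logical operators of `QRM_m(q, r)`. -/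
def levelIndex (m q r k : ℕ) : Finset (Finset (Fin m)) :=
  Finset.univ.filter fun K => q + k * r + 1 ≤ K.card ∧ K.card ≤ (k + 1) * r

/-- The index set `𝒬` of the logical qubits of `QRM_m(q, r)`: the `J ⊆ S` with
`q + 1 ≤ |J| ≤ r`. -/
def qubitIndex (m q r : ℕ) : Finset (Finset (Fin m)) :=
  Finset.univ.filter fun J => q + 1 ≤ J.card ∧ J.card ≤ r

/-- The collection `ℱ(K)` of minimal covers of `K ∈ 𝒬_k`: the sets of `k + 1` logical qubits whose
union is `K`. The level `k` is determined by `K`, as the `𝒬_k` are pairwise disjoint. If `K` lies in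
no `𝒬_k` (for instance if `K` is empty) there is no minimal cover. -/
def minimalCovers {m : ℕ} (q r : ℕ) (K : Finset (Fin m)) : Finset (Finset (Finset (Fin m))) :=
  open scoped Classical in
  (qubitIndex m q r).powerset.filter fun 𝒥 =>
    ∃ k : ℕ, K ∈ levelIndex m q r k ∧ 𝒥.biUnion id = K ∧ 𝒥.card = k + 1

/-! ### Logical multi-controlled-`Z` circuits -/

/-- The logical Pauli operator of the `J`-th logical qubit, `Z` on the standard subcube of `J`. -/
def logicalZ {m : ℕ} (J : Finset (Fin m)) : Op m := subcubeOp pauliZ (standardCube J)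

/-- The logical projector `|1⟩⟨1|` of the `J`-th logical qubit: the projector onto the
`-1` eigenspace of its logical `Z`. -/
def logicalOne {m : ℕ} (J : Finset (Fin m)) : Op m := (1 / 2 : ℂ) • (1 - logicalZ J)

theorem IsDiag.commute {m : ℕ} {A B : Op m} (hA : A.IsDiag) (hB : B.IsDiag) : Commute A B := by
  rw [← hA.diagonal_diag, ← hB.diagonal_diag]
  exact Matrix.commute_diagonal _ _

theorem IsDiag.mul {m : ℕ} {A B : Op m} (hA : A.IsDiag) (hB : B.IsDiag) : (A * B).IsDiag := by
  rw [← hA.diagonal_diag, ← hB.diagonal_diag, Matrix.diagonal_mul_diagonal]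
  exact Matrix.isDiag_diagonal _

theorem tensorOp_isDiag {m : ℕ} {U : Cube m → Gate} (hU : ∀ x, (U x).IsDiag) :
    (tensorOp U).IsDiag := by
  intro a b hab
  obtain ⟨x, hx⟩ := Function.ne_iff.1 hab
  exact Finset.prod_eq_zero (Finset.mem_univ x) (hU x hx)

theorem logicalZ_isDiag {m : ℕ} (J : Finset (Fin m)) : (logicalZ J).IsDiag := by
  apply tensorOp_isDiag
  intro x
  split_ifs
  · exact Matrix.isDiag_diagonal _
  · exact Matrix.isDiag_one

theorem logicalOne_isDiag {m : ℕ} (J : Finset (Fin m)) : (logicalOne J).IsDiag :=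
  (Matrix.isDiag_one.sub (logicalZ_isDiag J)).smul _

theorem logicalOne_pairwise {m : ℕ} (s : Set (Finset (Fin m))) :
    s.Pairwise (Function.onFun Commute (logicalOne (m := m))) :=
  fun J _ J' _ _ => IsDiag.commute (logicalOne_isDiag J) (logicalOne_isDiag J')

/-- The logical multi-controlled-`Z` gate on the set `𝒥` of logical qubits: the phase `-1` on the
logical basis states in which every qubit of `𝒥` is in state `|1⟩`, and the identity on the other
ones. By convention it is the identity for `𝒥 = ∅`. A diagonal gate in the logical computational
basis is a function of the logical `Z` operators, of which this basis is the joint eigenbasis. -/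
def controlledZ {m : ℕ} (𝒥 : Finset (Finset (Fin m))) : Op m :=
  if 𝒥 = ∅ then 1 else
    1 - (2 : ℂ) • 𝒥.noncommProd logicalOne (logicalOne_pairwise _)

theorem controlledZ_isDiag {m : ℕ} (𝒥 : Finset (Finset (Fin m))) : (controlledZ 𝒥).IsDiag := by
  unfold controlledZ
  split_ifs
  · exact Matrix.isDiag_one
  · refine Matrix.isDiag_one.sub (Matrix.IsDiag.smul _ ?_)
    exact Finset.noncommProd_induction _ _ _ (fun A : Op m => A.IsDiag)
      (fun _ _ hA hB => IsDiag.mul hA hB) Matrix.isDiag_one (fun J _ => logicalOne_isDiag J)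

theorem controlledZ_pairwise {m : ℕ} (s : Set (Finset (Finset (Fin m)))) :
    s.Pairwise (Function.onFun Commute (controlledZ (m := m))) :=
  fun J _ J' _ _ => IsDiag.commute (controlledZ_isDiag J) (controlledZ_isDiag J')

/-- The logical circuit consisting of the gates `controlledZ 𝒥` for `𝒥 ∈ ℱ`. -/
def controlledZCircuit {m : ℕ} (ℱ : Finset (Finset (Finset (Fin m)))) : Op m :=
  ℱ.noncommProd controlledZ (controlledZ_pairwise _)

theorem controlledZCircuit_isDiag {m : ℕ} (ℱ : Finset (Finset (Finset (Fin m)))) :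
    (controlledZCircuit ℱ).IsDiag :=
  Finset.noncommProd_induction _ _ _ (fun A : Op m => A.IsDiag)
    (fun _ _ hA hB => IsDiag.mul hA hB) Matrix.isDiag_one (fun J _ => controlledZ_isDiag J)

theorem facet_pairwise {m : ℕ} (q r : ℕ) (K : Finset (Fin m)) (s : Set (Fin m)) :
    s.Pairwise (Function.onFun Commute
      fun i => controlledZCircuit (minimalCovers q r (K.erase i))) :=
  fun _ _ _ _ _ => IsDiag.commute (controlledZCircuit_isDiag _) (controlledZCircuit_isDiag _)

/-- The logical circuit `∏_{i ∈ K} C^{ℱ(K ∖ {i})} Z` on `QRM_m(q, r)`. -/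
def facetCircuit {m : ℕ} (q r : ℕ) (K : Finset (Fin m)) : Op m :=
  K.noncommProd (fun i => controlledZCircuit (minimalCovers q r (K.erase i)))
    (facet_pairwise q r K _)

/-! The gates satisfy the recursion `C^{(ℓ)}Z = |0⟩⟨0| ⊗ I + |1⟩⟨1| ⊗ C^{(ℓ-1)}Z`,
`C^{(0)}Z = Z`, where `ℓ` is the number of controls. -/

theorem controlledZ_singleton {m : ℕ} (J : Finset (Fin m)) : controlledZ {J} = logicalZ J := by
  simp [controlledZ, logicalOne, smul_smul]

theorem controlledZ_insert {m : ℕ} (J : Finset (Fin m)) (𝒥 : Finset (Finset (Fin m)))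
    (hJ : J ∉ 𝒥) (h𝒥 : 𝒥.Nonempty) :
    controlledZ (insert J 𝒥) = (1 - logicalOne J) + logicalOne J * controlledZ 𝒥 := by
  simp only [controlledZ, Finset.insert_ne_empty, h𝒥.ne_empty, if_false]
  rw [Finset.noncommProd_insert_of_notMem _ _ _ _ hJ, mul_sub, mul_one, mul_smul_comm]
  abel

end QRM

end

/-! Every operator involved is diagonal, so phases are compared at each configuration `a` in the
support of a code state. Regard `a` as a polynomial over `ZMod 2`: the sign of logical Z on `J` is
given by its coefficient at `J`, and the Z stabilizers force degree at most `r`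
(`coeff_eq_zero_of_mem_code`). The X stabilizers play no role.

The phase of Z(k) on ⟨K⟩ depends only on the weight of `a` there modulo 2^(k+1). Expanding (-1)^a(s)
= (1-2)^n, with n the number of monomials of `a` inside s, and summing over s ⊆ K gives 2·weight =
-∑ (-2)^|𝒥| · 2^(|K|-|⋃𝒥|) over nonempty sets 𝒥 of monomials (`two_mul_weighted_sum`). Since |⋃𝒥| ≤
r|𝒥|, for |K| = kr+1 and r ≥ 2 each term is divisible by 2^(k+1), and is nonzero modulo 2^(k+2)
exactly for the minimal covers of K and of its facets K∖{i} (`cover_term_modEq`). This is (1).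

For (2), the two exponents differ by twice the weight on odd vertices. The same expansion,
restricted to odd s, shows that this is divisible by 2^(k+1) once |K| > kr+1
(`dvd_two_mul_odd_weight`). -/

namespace QRM

variable {m : ℕ}

/-! ### Bit strings and subsets -/

/-- The bit string with support `s`. -/
def indicator (s : Finset (Fin m)) : Cube m := fun i => if i ∈ s then 1 else 0

/-- Bit strings correspond to their supports. -/
def cubeEquiv (m : ℕ) : Finset (Fin m) ≃ Cube m where
  toFun := indicator
  invFun x := Finset.univ.filter fun i => x i ≠ 0
  left_inv s := by
    ext i
    simp [indicator]
  right_inv x := by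
    funext i
    have h : ∀ b : ZMod 2, (if b ≠ 0 then (1 : ZMod 2) else 0) = b := by decide
    simpa [indicator] using h (x i)

theorem indicator_mem_standardCube {s K : Finset (Fin m)} :
    indicator s ∈ standardCube K ↔ s ⊆ K := by
  simp only [standardCube, indicator, Set.mem_ofPred_eq, Finset.subset_iff, ite_eq_right_iff,
    one_ne_zero, imp_false]
  exact forall_congr' fun i => not_imp_not

theorem hammingNorm_indicator (s : Finset (Fin m)) : hammingNorm (indicator s) = s.card := by
  simp [hammingNorm, indicator]

theorem prod_cube {M : Type*} [CommMonoid M] (f : Cube m → M) :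
    ∏ x, f x = ∏ s : Finset (Fin m), f (indicator s) :=
  ((cubeEquiv m).prod_comp f).symm

/-! ### Möbius inversion over subsets modulo two -/

/-- The coefficient of the monomial `∏_{i ∈ J} x_i` in the polynomial over `ZMod 2` that represents
the function `a` on the cube. -/
def coeff (a : Config m) (J : Finset (Fin m)) : ZMod 2 := ∑ s ∈ J.powerset, a (indicator s)

/-- After exchanging sums, each t ⊆ s is counted 2^(|s|-|t|) times, which is even unless t = s. -/
theorem sum_coeff (a : Config m) (s : Finset (Fin m)) :
    ∑ J ∈ s.powerset, coeff a J = a (indicator s) := by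
  have h : ∀ t ∈ s.powerset, ∑ J ∈ Finset.Icc t s, a (indicator t) =
      if t = s then a (indicator s) else 0 := by
    intro t ht
    have hts := Finset.mem_powerset.1 ht
    rw [Finset.sum_const, Finset.card_Icc_finset hts]
    split_ifs with h
    · simp [h]
    · have hlt := Finset.card_lt_card (Finset.ssubset_iff_subset_ne.2 ⟨hts, h⟩)
      obtain ⟨d, hd⟩ : ∃ d, s.card - t.card = d + 1 := ⟨s.card - t.card - 1, by omega⟩
      rw [hd, pow_succ, mul_smul, two_nsmul, CharTwo.add_self_eq_zero, smul_zero]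
  simp only [coeff]
  rw [Finset.sum_comm' (t' := s.powerset) (s' := fun t => Finset.Icc t s), Finset.sum_congr rfl h]
  · simp
  · intro J t
    simp only [Finset.mem_powerset, Finset.mem_Icc]
    exact ⟨fun h => ⟨⟨h.2, h.1⟩, h.2.trans h.1⟩, fun h => ⟨h.1.2, h.1.1⟩⟩

/-- The subsets of `K` whose monomials occur in `a`. -/
def monomials (a : Config m) (K : Finset (Fin m)) : Finset (Finset (Fin m)) :=
  K.powerset.filter fun J => coeff a J = 1

theorem coeff_eq_indicator (a : Config m) (J : Finset (Fin m)) :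
    coeff a J = if coeff a J = 1 then 1 else 0 := by
  have h : ∀ b : ZMod 2, b = if b = 1 then 1 else 0 := by decide
  exact h _

theorem one_sub_two_mul (a : Config m) {K s : Finset (Fin m)} (hs : s ⊆ K) :
    (1 - 2 * (if a (indicator s) = 0 then 0 else 1) : ℤ) =
      ∑ 𝒥 ∈ (monomials a K).powerset, if 𝒥.biUnion id ⊆ s then (-2) ^ 𝒥.card else 0 := by
  have hfilter : (monomials a K).powerset.filter (fun 𝒥 => 𝒥.biUnion id ⊆ s) =
      (monomials a s).powerset := by
    ext 𝒥
    simp only [Finset.mem_filter, Finset.mem_powerset, Finset.biUnion_subset, id,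
      Finset.subset_iff (s₁ := 𝒥), monomials]
    exact ⟨fun h J hJ => ⟨h.2 J hJ, (h.1 hJ).2⟩,
      fun h => ⟨fun J hJ => ⟨(h hJ).1.trans hs, (h hJ).2⟩, fun J hJ => (h hJ).1⟩⟩
  have hcard : a (indicator s) = ((monomials a s).card : ZMod 2) := by
    rw [← sum_coeff a s, Finset.sum_congr rfl fun J _ => coeff_eq_indicator a J, monomials,
      Finset.sum_boole]
  rw [← Finset.sum_filter, hfilter]
  have hpow := Finset.sum_pow_mul_eq_add_pow (-2 : ℤ) 1 (monomials a s)
  simp only [one_pow, mul_one] at hpow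
  rw [hpow, hcard]
  simp only [ZMod.natCast_eq_zero_iff_even]
  rcases Nat.even_or_odd (monomials a s).card with h | h
  · norm_num [h, h.neg_one_pow]
  · norm_num [Nat.not_even_iff_odd.2 h, h.neg_one_pow]

/-- The term 𝒥 = ∅ cancels the total of `ε`. Constant weights serve part (1), the indicator of odd
cardinality part (2). -/
theorem two_mul_weighted_sum (a : Config m) (K : Finset (Fin m)) (ε : Finset (Fin m) → ℤ) :
    2 * ∑ s ∈ K.powerset, ε s * (if a (indicator s) = 0 then 0 else 1) =
      -∑ 𝒥 ∈ (monomials a K).powerset.erase ∅,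
        (-2) ^ 𝒥.card * ∑ s ∈ Finset.Icc (𝒥.biUnion id) K, ε s := by
  have h : ∑ s ∈ K.powerset, ε s * (1 - 2 * (if a (indicator s) = 0 then 0 else 1) : ℤ) =
      ∑ 𝒥 ∈ (monomials a K).powerset,
        (-2) ^ 𝒥.card * ∑ s ∈ Finset.Icc (𝒥.biUnion id) K, ε s := by
    rw [Finset.sum_congr rfl fun s hs => by
      rw [one_sub_two_mul a (Finset.mem_powerset.1 hs), Finset.mul_sum], Finset.sum_comm]
    refine Finset.sum_congr rfl fun 𝒥 _ => ?_
    have hIcc : Finset.Icc (𝒥.biUnion id) K = K.powerset.filter fun s => 𝒥.biUnion id ⊆ s := by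
      ext s
      simp [and_comm]
    rw [hIcc, Finset.mul_sum, Finset.sum_filter]
    refine Finset.sum_congr rfl fun s _ => ?_
    split_ifs <;> ring
  rw [← Finset.add_sum_erase (monomials a K).powerset _ (Finset.empty_mem_powerset _)] at h
  have h0 : Finset.Icc ((∅ : Finset (Finset (Fin m))).biUnion id) K = K.powerset := by
    ext s
    simp
  rw [h0, Finset.card_empty, pow_zero, one_mul] at h
  have h' : ∑ s ∈ K.powerset, ε s * (1 - 2 * (if a (indicator s) = 0 then 0 else 1) : ℤ) =
      ∑ s ∈ K.powerset, ε s -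
        2 * ∑ s ∈ K.powerset, ε s * (if a (indicator s) = 0 then 0 else 1) := by
    rw [Finset.mul_sum, ← Finset.sum_sub_distrib]
    exact Finset.sum_congr rfl fun s _ => by ring
  linarith

/-- A proper interval contains as many odd as even sets, because its alternating sum vanishes. -/
theorem two_mul_card_odd_Icc {U K : Finset (Fin m)} (h : U ⊂ K) :
    2 * ∑ s ∈ Finset.Icc U K, (if Even s.card then 0 else 1 : ℤ) = 2 ^ (K.card - U.card) := by
  have hsign : ∑ s ∈ Finset.Icc U K, (-1 : ℤ) ^ s.card = 0 := by
    have hne : K \ U ≠ ∅ := by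
      rw [Ne, Finset.sdiff_eq_empty_iff_subset]
      exact h.2
    have hdisj : ∀ t ∈ (K \ U).powerset, Disjoint U t := fun t ht =>
      Finset.disjoint_of_subset_right (Finset.mem_powerset.1 ht) Finset.disjoint_sdiff
    rw [Finset.Icc_eq_image_powerset h.1, Finset.sum_image]
    · rw [Finset.sum_congr rfl fun t ht => by
        rw [Finset.card_union_of_disjoint (hdisj t ht), pow_add], ← Finset.mul_sum,
        Finset.sum_powerset_neg_one_pow_card_of_nonempty (Finset.nonempty_iff_ne_empty.2 hne),
        mul_zero]
    · intro s hs t ht hst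
      rw [← Finset.union_sdiff_cancel_left (hdisj s hs),
        ← Finset.union_sdiff_cancel_left (hdisj t ht)]
      exact congrArg (· \ U) hst
  have hcard : ∑ _s ∈ Finset.Icc U K, (1 : ℤ) = 2 ^ (K.card - U.card) := by
    simp [Finset.card_Icc_finset h.1]
  have hdiff : ∑ s ∈ Finset.Icc U K, (1 - (-1 : ℤ) ^ s.card) = 2 ^ (K.card - U.card) := by
    rw [Finset.sum_sub_distrib, hsign, sub_zero, hcard]
  rw [← hdiff, Finset.mul_sum]
  refine Finset.sum_congr rfl fun s _ => ?_
  rcases Nat.even_or_odd s.card with hs | hs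
  · simp [hs]
  · norm_num [Nat.not_even_iff_odd.2 hs, hs.neg_one_pow]

/-! ### Divisibility of weights -/

theorem card_biUnion_le {𝒥 : Finset (Finset (Fin m))} {r : ℕ} (h : ∀ J ∈ 𝒥, J.card ≤ r) :
    (𝒥.biUnion id).card ≤ 𝒥.card * r :=
  Finset.card_biUnion_le_card_mul _ _ _ h

/-- The constant monomial ∅ may occur in `a` but is not a logical qubit. It covers nothing, and this
sharper bound excludes it from the extremal families. -/
theorem card_biUnion_le_of_empty_mem {𝒥 : Finset (Finset (Fin m))} {r : ℕ}
    (h : ∀ J ∈ 𝒥, J.card ≤ r) (h0 : ∅ ∈ 𝒥) : (𝒥.biUnion id).card ≤ (𝒥.card - 1) * r := by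
  have h1 : 𝒥.biUnion id = (𝒥.erase ∅).biUnion id := by
    conv_lhs => rw [← Finset.insert_erase h0, Finset.biUnion_insert, id, Finset.empty_union]
  rw [h1, ← Finset.card_erase_of_mem h0]
  exact card_biUnion_le fun J hJ => h J (Finset.mem_of_mem_erase hJ)

theorem biUnion_subset_of_mem {a : Config m} {K : Finset (Fin m)} {𝒥 : Finset (Finset (Fin m))}
    (h : 𝒥 ⊆ monomials a K) : 𝒥.biUnion id ⊆ K :=
  Finset.biUnion_subset.2 fun _ hJ => Finset.mem_powerset.1 (Finset.mem_filter.1 (h hJ)).1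

/-- Here n = |K|, u = |⋃𝒥|, j = |𝒥|. Otherwise n ≤ jr + (n-u-1) + 1 ≤ (j+n-u-1)r + 1 ≤ kr + 1. The
target is k+2 because the odd count supplies only 2^(n-u-1). -/
theorem exponent_bound {k r n u j : ℕ} (hr : 1 ≤ r) (hu : u ≤ j * r) (hn : k * r + 1 < n)
    (hun : u < n) : k + 2 ≤ j + (n - u) := by
  by_contra! hlt
  obtain ⟨d, rfl⟩ : ∃ d, n = u + d + 1 := ⟨n - u - 1, by omega⟩
  obtain ⟨e, rfl⟩ : ∃ e, k = j + d + e := ⟨k - j - d, by omega⟩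
  have hd := Nat.mul_le_mul_left d hr
  have : (j + d + e) * r = j * r + d * r + e * r := by ring
  have := Nat.zero_le (e * r)
  omega

theorem dvd_two_mul_odd_weight {a : Config m} {K : Finset (Fin m)} {k r : ℕ} (hr : 1 ≤ r)
    (hK : k * r + 1 < K.card) (ha : ∀ J, r < J.card → coeff a J = 0) :
    (2 : ℤ) ^ (k + 1) ∣ 2 * ∑ s ∈ K.powerset,
      (if Even s.card then 0 else 1) * (if a (indicator s) = 0 then 0 else 1) := by
  rw [two_mul_weighted_sum, dvd_neg]
  refine Finset.dvd_sum fun 𝒥 h𝒥 => ?_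
  have hsub := Finset.mem_powerset.1 (Finset.mem_of_mem_erase h𝒥)
  have hcard : ∀ J ∈ 𝒥, J.card ≤ r := by
    intro J hJ
    by_contra! hlt
    have h1 := (Finset.mem_filter.1 (hsub hJ)).2
    rw [ha J hlt] at h1
    exact zero_ne_one h1
  have hle := card_biUnion_le hcard
  by_cases hU : 𝒥.biUnion id = K
  · rw [hU] at hle
    have hj : k + 1 ≤ 𝒥.card := by
      by_contra! hlt
      have := Nat.mul_le_mul_right r (Nat.lt_succ_iff.1 hlt)
      omega
    refine Dvd.dvd.mul_right ?_ _
    exact (pow_dvd_pow 2 hj).trans (pow_dvd_pow_of_dvd (by norm_num) _)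
  · have hss : 𝒥.biUnion id ⊂ K :=
      Finset.ssubset_iff_subset_ne.2 ⟨biUnion_subset_of_mem hsub, hU⟩
    have hexp := exponent_bound hr hle hK (Finset.card_lt_card hss)
    have hodd := two_mul_card_odd_Icc hss
    refine (mul_dvd_mul_iff_left (two_ne_zero (α := ℤ))).1 ?_
    rw [mul_left_comm, hodd, ← pow_succ', neg_pow, mul_assoc, ← pow_add]
    exact Dvd.dvd.mul_left (pow_dvd_pow 2 hexp) _

theorem mem_minimalCovers_iff {q r : ℕ} {K : Finset (Fin m)} {𝒥 : Finset (Finset (Fin m))} :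
    𝒥 ∈ minimalCovers q r K ↔ 𝒥 ⊆ qubitIndex m q r ∧ ∃ k, (q + k * r + 1 ≤ K.card ∧
      K.card ≤ (k + 1) * r) ∧ 𝒥.biUnion id = K ∧ 𝒥.card = k + 1 := by
  classical
  refine Finset.mem_filter.trans ?_
  rw [Finset.mem_powerset]
  simp only [levelIndex, Finset.mem_filter, Finset.mem_univ, true_and]

/-- The inequalities kr < |K| ≤ (k+1)r determine the level. -/
theorem mem_minimalCovers {q r k : ℕ} {K : Finset (Fin m)} (h1 : q + k * r + 1 ≤ K.card)
    (h2 : K.card ≤ (k + 1) * r) {𝒥 : Finset (Finset (Fin m))} :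
    𝒥 ∈ minimalCovers q r K ↔ 𝒥 ⊆ qubitIndex m q r ∧ 𝒥.biUnion id = K ∧ 𝒥.card = k + 1 := by
  rw [mem_minimalCovers_iff]
  constructor
  · rintro ⟨hq, l, ⟨hl1, hl2⟩, hU, hc⟩
    refine ⟨hq, hU, ?_⟩
    have hkl : k < l + 1 := Nat.lt_of_mul_lt_mul_right (a := r) (by omega)
    have hlk : l < k + 1 := Nat.lt_of_mul_lt_mul_right (a := r) (by omega)
    omega
  · rintro ⟨hq, hU, hc⟩
    exact ⟨hq, k, ⟨h1, h2⟩, hU, hc⟩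

theorem biUnion_of_mem_minimalCovers {q r : ℕ} {K : Finset (Fin m)}
    {𝒥 : Finset (Finset (Fin m))} (h : 𝒥 ∈ minimalCovers q r K) : 𝒥.biUnion id = K := by
  obtain ⟨-, -, -, hU, -⟩ := mem_minimalCovers_iff.1 h
  exact hU

theorem nonempty_of_mem_minimalCovers {q r : ℕ} {K : Finset (Fin m)}
    {𝒥 : Finset (Finset (Fin m))} (h : 𝒥 ∈ minimalCovers q r K) : 𝒥.Nonempty := by
  obtain ⟨-, k, -, -, hc⟩ := mem_minimalCovers_iff.1 h
  exact Finset.card_pos.1 (by omega)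

/-- Facets have kr elements and so lie one level lower, with covers of size k. For k = 0 there is no
level, and both sides fail for nonempty 𝒥. -/
theorem mem_minimalCovers_of_card_eq_mul {r k : ℕ} (hr : 1 ≤ r) {U : Finset (Fin m)}
    (hU : U.card = k * r) {𝒥 : Finset (Finset (Fin m))} (hne : 𝒥.Nonempty) :
    𝒥 ∈ minimalCovers 0 r U ↔ 𝒥 ⊆ qubitIndex m 0 r ∧ 𝒥.biUnion id = U ∧ 𝒥.card = k := by
  cases k with
  | zero =>
    have := Finset.card_pos.2 hne
    refine ⟨fun h => ?_, fun h => by omega⟩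
    obtain ⟨-, k, hk, -⟩ := mem_minimalCovers_iff.1 h
    omega
  | succ k =>
    refine mem_minimalCovers ?_ hU.le
    rw [hU, Nat.succ_mul]
    omega

theorem subset_qubitIndex {𝒥 : Finset (Finset (Fin m))} {r : ℕ} (hcard : ∀ J ∈ 𝒥, J.card ≤ r)
    (h0 : ∅ ∉ 𝒥) : 𝒥 ⊆ qubitIndex m 0 r := by
  intro J hJ
  have : 0 < J.card := Finset.card_pos.2 <| Finset.nonempty_iff_ne_empty.2 fun h => h0 (h ▸ hJ)
  simp only [qubitIndex, Finset.mem_filter, Finset.mem_univ, true_and]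
  exact ⟨by omega, hcard J hJ⟩

/-- The sign is immaterial, as 2^(k+1) and its negative agree modulo 2^(k+2). -/
theorem neg_two_pow_modEq {e k c : ℕ} (he : c + e = k + 1) :
    (-2 : ℤ) ^ c * 2 ^ e ≡ 2 ^ (k + 1) [ZMOD 2 ^ (k + 2)] := by
  rw [neg_pow, mul_assoc, ← pow_add, he]
  rcases neg_one_pow_eq_or ℤ c with h | h <;> rw [h]
  · rw [one_mul]
  · refine Int.modEq_iff_dvd.2 ⟨1, ?_⟩
    ring

open scoped Classical in
theorem cover_term_modEq {K : Finset (Fin m)} {k r : ℕ} (hr : 2 ≤ r) (hK : K.card = k * r + 1)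
    {𝒥 : Finset (Finset (Fin m))} (hne : 𝒥.Nonempty) (hcard : ∀ J ∈ 𝒥, J.card ≤ r)
    (hsub : 𝒥.biUnion id ⊆ K) :
    (-2 : ℤ) ^ 𝒥.card * 2 ^ (K.card - (𝒥.biUnion id).card) ≡
      2 ^ (k + 1) * ((if 𝒥 ∈ minimalCovers 0 r K then 1 else 0) +
        ∑ i ∈ K, if 𝒥 ∈ minimalCovers 0 r (K.erase i) then 1 else 0) [ZMOD 2 ^ (k + 2)] := by
  have hle := card_biUnion_le hcard
  have hmemK := mem_minimalCovers (q := 0) (r := r) (k := k) (K := K) (by omega)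
    (by rw [hK, Nat.succ_mul]; omega) (𝒥 := 𝒥)
  have hcardE : ∀ i ∈ K, (K.erase i).card = k * r := fun i hi => by
    rw [Finset.card_erase_of_mem hi, hK, Nat.add_sub_cancel]
  have hmemE := fun i hi =>
    mem_minimalCovers_of_card_eq_mul (by omega : 1 ≤ r) (hcardE i hi) hne
  -- A cover determines its union, so at most one of the indicators on the right is nonzero.
  by_cases h1 : 𝒥 ∈ minimalCovers 0 r K
  · have h2 : ∀ i ∈ K, (if 𝒥 ∈ minimalCovers 0 r (K.erase i) then 1 else 0 : ℤ) = 0 := by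
      intro i hi
      rw [if_neg]
      intro h
      have := biUnion_of_mem_minimalCovers h
      rw [biUnion_of_mem_minimalCovers h1] at this
      exact Finset.notMem_erase i K (this ▸ hi)
    rw [if_pos h1, Finset.sum_eq_zero h2, add_zero, mul_one]
    obtain ⟨-, hU, hc⟩ := hmemK.1 h1
    exact neg_two_pow_modEq (by rw [hU, hc]; omega)
  rw [if_neg h1, zero_add]
  by_cases h2 : ∃ i ∈ K, 𝒥 ∈ minimalCovers 0 r (K.erase i)
  · obtain ⟨i, hi, h⟩ := h2
    rw [Finset.sum_eq_single_of_mem i hi, if_pos h, mul_one]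
    · obtain ⟨-, hU, hc⟩ := (hmemE i hi).1 h
      exact neg_two_pow_modEq (by rw [hU, hc, hcardE i hi]; omega)
    · intro l hl hli
      rw [if_neg]
      intro h'
      have := biUnion_of_mem_minimalCovers h'
      rw [biUnion_of_mem_minimalCovers h] at this
      exact Finset.notMem_erase l K (this ▸ Finset.mem_erase.2 ⟨hli, hl⟩)
  · push Not at h2
    rw [Finset.sum_eq_zero fun i hi => if_neg (h2 i hi), mul_zero]
    refine Int.modEq_zero_iff_dvd.2 ?_
    rw [neg_pow, mul_assoc, ← pow_add]
    refine Dvd.dvd.mul_left (pow_dvd_pow 2 ?_) _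
    have hpos := Finset.card_pos.2 hne
    have hempty := card_biUnion_le_of_empty_mem hcard
    by_contra! hlt
    have hUK := Finset.card_le_card hsub
    obtain ⟨d, hd⟩ : ∃ d, K.card = (𝒥.biUnion id).card + d := ⟨_, (Nat.add_sub_of_le hUK).symm⟩
    obtain ⟨j, hj⟩ : ∃ j, 𝒥.card = j + 1 := ⟨𝒥.card - 1, by omega⟩
    have hjr : (j + 1) * r = j * r + r := Nat.succ_mul j r
    rw [hj] at hle hempty
    rw [Nat.add_sub_cancel] at hempty
    -- Here d counts the points of K missed by 𝒥. An exponent of at most k+1 makes 𝒥 a minimal cover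
    -- of K when d = 0, and of a facet when d = 1.
    rcases d with _ | _ | d
    · have hU : 𝒥.biUnion id = K := Finset.eq_of_subset_of_card_le hsub (by omega)
      have hkj : k < j + 1 := Nat.lt_of_mul_lt_mul_right (a := r) (by omega)
      have hjk : j = k := by omega
      subst hjk
      refine h1 (hmemK.2 ⟨subset_qubitIndex hcard fun h0 => ?_, hU, hj⟩)
      have := hempty h0
      omega
    · have hkj : k ≤ j + 1 := Nat.le_of_mul_le_mul_right (c := r) (by omega) (by omega)
      have hjk : k = j + 1 := by omega
      subst hjk
      obtain ⟨i, hi⟩ : (K \ 𝒥.biUnion id).Nonempty := by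
        rw [← Finset.card_pos, Finset.card_sdiff_of_subset hsub]
        omega
      rw [Finset.mem_sdiff] at hi
      have hU : 𝒥.biUnion id = K.erase i := by
        refine Finset.eq_of_subset_of_card_le (Finset.subset_erase.2 ⟨hsub, hi.2⟩) ?_
        rw [hcardE i hi.1]
        omega
      refine h2 i hi.1 ((hmemE i hi.1).2 ⟨subset_qubitIndex hcard fun h0 => ?_, hU, hj⟩)
      have := hempty h0
      omega
    -- With two or more missed points, the size bound contradicts r ≥ 2. For r = 1 it would not:
    -- families of singletons missing several points also reach exponent k+1.
    · obtain ⟨e, rfl⟩ : ∃ e, k = j + 1 + d + 1 + e := ⟨k - j - d - 2, by omega⟩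
      have he : (j + 1 + d + 1 + e) * r = j * r + r + d * r + r + e * r := by ring
      have hd' : d * 1 ≤ d * r := Nat.mul_le_mul_left d (by omega)
      have := Nat.zero_le (e * r)
      omega

/-- The number of gates of the circuit `ℱ` that act as `-1` on the configuration `a`. -/
def activeCount (a : Config m) (ℱ : Finset (Finset (Finset (Fin m)))) : ℕ :=
  (ℱ.filter fun 𝒥 => ∀ J ∈ 𝒥, coeff a J = 1).card

open scoped Classical in
theorem sum_mem_minimalCovers (a : Config m) {q r : ℕ} {K L : Finset (Fin m)} (hL : L ⊆ K) :
    ∑ 𝒥 ∈ (monomials a K).powerset.erase ∅,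
      (if 𝒥 ∈ minimalCovers q r L then 1 else 0 : ℤ) = activeCount a (minimalCovers q r L) := by
  rw [Finset.sum_boole, activeCount]
  congr 2
  ext 𝒥
  simp only [Finset.mem_filter, Finset.mem_erase, Finset.mem_powerset, monomials,
    Finset.subset_iff (s₁ := 𝒥)]
  constructor
  · exact fun h => ⟨h.2, fun J hJ => (h.1.2 hJ).2⟩
  · refine fun h => ⟨⟨(nonempty_of_mem_minimalCovers h.1).ne_empty, fun J hJ => ⟨?_, h.2 J hJ⟩⟩, h.1⟩
    have : J ⊆ 𝒥.biUnion id := Finset.subset_biUnion_of_mem id hJ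
    exact (biUnion_of_mem_minimalCovers h.1 ▸ this).trans hL

theorem weight_modEq {a : Config m} {K : Finset (Fin m)} {k r : ℕ} (hr : 2 ≤ r)
    (hK : K.card = k * r + 1) (ha : ∀ J, r < J.card → coeff a J = 0) :
    ∑ s ∈ K.powerset, (if a (indicator s) = 0 then 0 else 1 : ℤ) ≡
      2 ^ k * (activeCount a (minimalCovers 0 r K) +
        ∑ i ∈ K, activeCount a (minimalCovers 0 r (K.erase i)) : ℕ) [ZMOD 2 ^ (k + 1)] := by
  classical
  have hw := two_mul_weighted_sum a K fun _ => 1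
  simp only [one_mul] at hw
  have hterm : ∀ 𝒥 ∈ (monomials a K).powerset.erase ∅,
      (-2 : ℤ) ^ 𝒥.card * ∑ _s ∈ Finset.Icc (𝒥.biUnion id) K, 1 ≡
        2 ^ (k + 1) * ((if 𝒥 ∈ minimalCovers 0 r K then 1 else 0) +
          ∑ i ∈ K, if 𝒥 ∈ minimalCovers 0 r (K.erase i) then 1 else 0) [ZMOD 2 ^ (k + 2)] := by
    intro 𝒥 h𝒥
    rw [Finset.mem_erase, Finset.mem_powerset] at h𝒥
    have hsub := biUnion_subset_of_mem h𝒥.2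
    rw [Finset.sum_const, Finset.card_Icc_finset hsub, nsmul_one, Nat.cast_pow, Nat.cast_ofNat]
    refine cover_term_modEq hr hK (Finset.nonempty_iff_ne_empty.2 h𝒥.1) (fun J hJ => ?_) hsub
    by_contra! hlt
    have h1 := (Finset.mem_filter.1 (h𝒥.2 hJ)).2
    rw [ha J hlt] at h1
    exact zero_ne_one h1
  have hsum := Int.ModEq.sum hterm
  rw [← Finset.mul_sum, Finset.sum_add_distrib, Finset.sum_comm,
    sum_mem_minimalCovers a (Finset.Subset.refl K),
    Finset.sum_congr rfl fun i _ => sum_mem_minimalCovers a (Finset.erase_subset i K)] at hsum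
  have h2 := hw ▸ hsum.neg
  rw [Int.modEq_iff_dvd] at h2 ⊢
  rw [pow_succ' 2 (k + 1)] at h2
  refine (mul_dvd_mul_iff_left (two_ne_zero (α := ℤ))).1 ?_
  push_cast
  generalize ((activeCount a (minimalCovers 0 r K) : ℤ) +
    ∑ i ∈ K, (activeCount a (minimalCovers 0 r (K.erase i)) : ℤ)) = N at h2 ⊢
  -- Adding N·2^(k+2) turns -2^(k+1)·N into 2^(k+1)·N, absorbing the minus sign of the expansion.
  have h3 := dvd_add h2 (Dvd.intro_left N (rfl : N * (2 * 2 ^ (k + 1) : ℤ) = _))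
  convert h3 using 1
  ring

/-! ### Diagonal operators -/

theorem tensorOp_diagonal (g : Cube m → ZMod 2 → ℂ) :
    tensorOp (fun x => Matrix.diagonal (g x)) = Matrix.diagonal fun a => ∏ x, g x (a x) := by
  have hdiag := tensorOp_isDiag fun x => Matrix.isDiag_diagonal (g x)
  rw [← hdiag.diagonal_diag]
  congr 1
  funext a
  simp [tensorOp]

open scoped Classical in
theorem subcubeOp_diagonal (g : ZMod 2 → ℂ) (A : Set (Cube m)) :
    subcubeOp (Matrix.diagonal g) A =
      Matrix.diagonal fun a => ∏ x, if x ∈ A then g (a x) else 1 := by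
  have h : (fun x => if x ∈ A then Matrix.diagonal g else 1) =
      fun x => Matrix.diagonal (if x ∈ A then g else 1) := by
    funext x
    split_ifs <;> simp
  rw [subcubeOp, h, tensorOp_diagonal]
  congr 1
  funext a
  refine Finset.prod_congr rfl fun x _ => ?_
  split_ifs <;> rfl

open scoped Classical in
theorem prod_ite_mem_standardCube {M : Type*} [CommMonoid M] (K : Finset (Fin m))
    (f : Cube m → M) :
    (∏ x, if x ∈ standardCube K then f x else 1) = ∏ s ∈ K.powerset, f (indicator s) := by
  rw [prod_cube, ← Finset.prod_filter]
  refine Finset.prod_congr ?_ fun _ _ => rfl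
  ext s
  simp [indicator_mem_standardCube]

/-- The character of `ZMod 2` with values `1` and `-1`. -/
noncomputable def sign (b : ZMod 2) : ℂ := if b = 0 then 1 else -1

theorem sign_add (b c : ZMod 2) : sign (b + c) = sign b * sign c := by
  have h : ∀ b : ZMod 2, b = 0 ∨ b = 1 := by decide
  have h2 : (1 + 1 : ZMod 2) = 0 := by decide
  rcases h b with rfl | rfl <;> rcases h c with rfl | rfl <;> simp [sign, h2]

theorem sign_sum {ι : Type*} (s : Finset ι) (f : ι → ZMod 2) :
    sign (∑ i ∈ s, f i) = ∏ i ∈ s, sign (f i) := by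
  classical
  induction s using Finset.induction_on with
  | empty => simp [sign]
  | insert i s hi ih => rw [Finset.sum_insert hi, Finset.prod_insert hi, sign_add, ih]

theorem sign_eq_one {b : ZMod 2} : sign b = 1 ↔ b = 0 := by
  unfold sign
  split_ifs with h <;> norm_num [h]

theorem pauliZ_eq : pauliZ = Matrix.diagonal sign := rfl

/-- The parity of `a` on ⟨J⟩ is exactly its Möbius coefficient at `J`. -/
theorem logicalZ_eq (J : Finset (Fin m)) :
    logicalZ J = Matrix.diagonal fun a => sign (coeff a J) := by
  rw [logicalZ, pauliZ_eq, subcubeOp_diagonal]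
  congr 1
  funext a
  rw [prod_ite_mem_standardCube (K := J) (f := fun x => sign (a x)), coeff, sign_sum]

theorem logicalOne_eq (J : Finset (Fin m)) :
    logicalOne J = Matrix.diagonal fun a => if coeff a J = 1 then 1 else 0 := by
  rw [logicalOne, logicalZ_eq, ← Matrix.diagonal_one, Matrix.diagonal_sub, ← Matrix.diagonal_smul]
  congr 1
  funext a
  have h : ∀ b : ZMod 2, b = 0 ∨ b = 1 := by decide
  rcases h (coeff a J) with h | h <;> norm_num [h, sign]

theorem noncommProd_eq_diagonal {ι : Type*} (s : Finset ι) (f : ι → Op m) (comm)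
    (g : ι → Config m → ℂ) (h : ∀ i ∈ s, f i = Matrix.diagonal (g i)) :
    s.noncommProd f comm = Matrix.diagonal fun a => ∏ i ∈ s, g i a := by
  classical
  induction s using Finset.induction_on with
  | empty => simp
  | insert i s hi ih =>
    rw [Finset.noncommProd_insert_of_notMem _ _ _ _ hi,
      ih _ fun j hj => h j (Finset.mem_insert_of_mem hj), h i (Finset.mem_insert_self i s),
      Matrix.diagonal_mul_diagonal]
    simp only [Finset.prod_insert hi]

theorem controlledZ_eq {𝒥 : Finset (Finset (Fin m))} (h : 𝒥.Nonempty) :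
    controlledZ 𝒥 =
      Matrix.diagonal fun a => if ∀ J ∈ 𝒥, coeff a J = 1 then (-1 : ℂ) else 1 := by
  rw [controlledZ, if_neg h.ne_empty,
    noncommProd_eq_diagonal 𝒥 logicalOne _ _ fun J _ => logicalOne_eq J, ← Matrix.diagonal_one,
    ← Matrix.diagonal_smul, Matrix.diagonal_sub]
  congr 1
  funext a
  simp only [Pi.smul_apply, Finset.prod_ite_zero, Finset.prod_const_one]
  split_ifs <;> norm_num

theorem controlledZCircuit_minimalCovers (q r : ℕ) (K : Finset (Fin m)) :
    controlledZCircuit (minimalCovers q r K) =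
      Matrix.diagonal fun a => (-1 : ℂ) ^ activeCount a (minimalCovers q r K) := by
  rw [controlledZCircuit, noncommProd_eq_diagonal _ _ _ _ fun 𝒥 h𝒥 =>
    controlledZ_eq (nonempty_of_mem_minimalCovers h𝒥)]
  congr 1
  funext a
  rw [← Finset.prod_filter, Finset.prod_const, activeCount]

theorem facetCircuit_eq (q r : ℕ) (K : Finset (Fin m)) :
    facetCircuit q r K =
      Matrix.diagonal fun a => (-1 : ℂ) ^ ∑ i ∈ K, activeCount a (minimalCovers q r (K.erase i)) := by
  rw [facetCircuit, noncommProd_eq_diagonal _ _ _ _ fun i _ =>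
    controlledZCircuit_minimalCovers q r (K.erase i)]
  simp only [Finset.prod_pow_eq_pow_sum]

/-! ### Phases -/

/-- The phase `exp (i π / 2 ^ k)`. -/
noncomputable def phase (k : ℕ) : ℂ := Complex.exp (Complex.I * Real.pi / 2 ^ k)

theorem phase_ne_zero (k : ℕ) : phase k ≠ 0 := Complex.exp_ne_zero _

theorem phase_pow (k : ℕ) : phase k ^ 2 ^ k = -1 := by
  rw [phase, ← Complex.exp_nat_mul, ← Complex.exp_pi_mul_I]
  congr 1
  push_cast
  field_simp

theorem star_phase (k : ℕ) : star (phase k) = (phase k)⁻¹ := by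
  rw [phase, Complex.star_def, ← Complex.exp_conj, ← Complex.exp_neg]
  congr 1
  rw [map_div₀, map_mul, map_pow, Complex.conj_I, Complex.conj_ofReal, map_ofNat, neg_mul, neg_div]

/-- The phase is a root of unity of order dividing 2^(k+1). Integer exponents accommodate the
adjoint gates. -/
theorem phase_zpow_eq {k : ℕ} {u v : ℤ} (h : u ≡ v [ZMOD 2 ^ (k + 1)]) :
    phase k ^ u = phase k ^ v := by
  obtain ⟨c, hc⟩ := Int.modEq_iff_dvd.1 h
  have h1 : phase k ^ ((2 : ℤ) ^ (k + 1)) = 1 := by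
    have : ((2 : ℤ) ^ (k + 1)) = ((2 ^ (k + 1) : ℕ) : ℤ) := by push_cast; rfl
    rw [this, zpow_natCast, pow_succ, pow_mul, phase_pow, neg_one_sq]
  rw [sub_eq_iff_eq_add.1 hc, zpow_add₀ (phase_ne_zero k), zpow_mul, h1, one_zpow, one_mul]

theorem phase_zpow_mul (k n : ℕ) : phase k ^ (2 ^ k * n : ℤ) = (-1) ^ n := by
  rw [← phase_pow k, ← pow_mul, ← zpow_natCast]
  push_cast
  rfl

theorem prod_phase_zpow (k : ℕ) {ι : Type*} (s : Finset ι) (n : ι → ℤ) :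
    ∏ i ∈ s, phase k ^ n i = phase k ^ ∑ i ∈ s, n i := by
  classical
  induction s using Finset.induction_on with
  | empty => simp
  | insert i s hi ih =>
    rw [Finset.prod_insert hi, Finset.sum_insert hi, ih, zpow_add₀ (phase_ne_zero k)]

theorem zGate_eq (k : ℕ) :
    zGate k = Matrix.diagonal fun b => phase k ^ (if b = 0 then 0 else 1 : ℤ) := by
  rw [zGate]
  congr 1
  funext b
  split_ifs <;> simp [phase]

theorem zGate_conjTranspose (k : ℕ) :
    (zGate k)ᴴ = Matrix.diagonal fun b => phase k ^ (-(if b = 0 then 0 else 1) : ℤ) := by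
  rw [zGate, Matrix.diagonal_conjTranspose]
  congr 1
  funext b
  rw [Pi.star_apply]
  split_ifs
  · simp
  · rw [zpow_neg_one, ← star_phase, phase]

theorem subcubeOp_zGate (k : ℕ) (K : Finset (Fin m)) :
    subcubeOp (zGate k) (standardCube K) = Matrix.diagonal fun a =>
      phase k ^ ∑ s ∈ K.powerset, (if a (indicator s) = 0 then 0 else 1 : ℤ) := by
  rw [zGate_eq, subcubeOp_diagonal]
  congr 1
  funext a
  rw [prod_ite_mem_standardCube (K := K)
    (f := fun x => phase k ^ (if a x = 0 then 0 else 1 : ℤ)), prod_phase_zpow]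

theorem signedOp_standardCube (k : ℕ) (K : Finset (Fin m)) :
    signedOp k (standardCube K) = Matrix.diagonal fun a =>
      phase k ^ ∑ s ∈ K.powerset,
        ((if Even s.card then 1 else -1) * (if a (indicator s) = 0 then 0 else 1) : ℤ) := by
  classical
  have h : ∀ x : Cube m, (if x ∈ standardCube K then
      (if Even (hammingNorm x) then zGate k else (zGate k)ᴴ) else 1) =
      Matrix.diagonal fun b => if x ∈ standardCube K then phase k ^
        ((if Even (hammingNorm x) then 1 else -1) * (if b = 0 then 0 else 1) : ℤ) else 1 := by
    intro x
    split_ifs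
    · simp only [one_mul, zGate_eq]
    · simp only [neg_one_mul, zGate_conjTranspose]
    · exact Matrix.diagonal_one.symm
  rw [signedOp]
  simp only [h]
  rw [tensorOp_diagonal]
  congr 1
  funext a
  rw [prod_ite_mem_standardCube (K := K) (f := fun x => phase k ^
    ((if Even (hammingNorm x) then 1 else -1) * (if a x = 0 then 0 else 1) : ℤ)),
    prod_phase_zpow]
  simp only [hammingNorm_indicator]

/-! ### The support of code states -/

theorem indicator_mem_subcube {s t J : Finset (Fin m)} :
    indicator s ∈ subcube (indicator t) J ↔ s \ J = t \ J := by
  simp only [subcube, standardCube, indicator, Set.mem_ofPred_eq, Pi.sub_apply, Finset.ext_iff,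
    Finset.mem_sdiff]
  refine forall_congr' fun i => ?_
  by_cases hJ : i ∈ J <;> by_cases hs : i ∈ s <;> by_cases ht : i ∈ t <;> simp [hJ, hs, ht]

/-- Choose L ⊆ J with r+1 elements. The translates of ⟨L⟩ partition ⟨J⟩, and the Z stabilizer on
each makes the parity of `a` there zero. -/
theorem coeff_eq_zero_of_mem_code {q r : ℕ} {ψ : State m} (hψ : ψ ∈ code m q r) {a : Config m}
    (ha : ψ a ≠ 0) {J : Finset (Fin m)} (hJ : r < J.card) : coeff a J = 0 := by
  classical
  obtain ⟨L, hL, hLcard⟩ := Finset.exists_subset_card_eq hJ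
  have hmaps : ∀ s ∈ J.powerset, s \ L ∈ (J \ L).powerset := fun s hs =>
    Finset.mem_powerset.2 (Finset.sdiff_subset_sdiff (Finset.mem_powerset.1 hs) le_rfl)
  rw [coeff, ← Finset.sum_fiberwise_of_maps_to hmaps]
  refine Finset.sum_eq_zero fun t ht => ?_
  have h := congrFun (hψ.2 (indicator t) L hLcard) a
  rw [pauliZ_eq, subcubeOp_diagonal, Matrix.mulVec_diagonal, mul_eq_right₀ ha, prod_cube,
    ← Finset.prod_filter, ← sign_sum, sign_eq_one] at h
  rw [← h]
  refine Finset.sum_congr ?_ fun _ _ => rfl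
  have ht' : t \ L = t := Finset.sdiff_eq_self_of_disjoint
    (Finset.disjoint_of_subset_left (Finset.mem_powerset.1 ht) Finset.sdiff_disjoint)
  ext s
  simp only [Finset.mem_filter, Finset.mem_powerset, Finset.mem_univ, true_and,
    indicator_mem_subcube, ht']
  refine ⟨fun h => h.2, fun h => ⟨fun i hi => ?_, h⟩⟩
  by_cases hiL : i ∈ L
  · exact hL hiL
  · have : i ∈ t := h ▸ Finset.mem_sdiff.2 ⟨hi, hiL⟩
    exact (Finset.mem_sdiff.1 (Finset.mem_powerset.1 ht this)).1

theorem logicallyEquiv_diagonal {q r : ℕ} {f g : Config m → ℂ}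
    (h : ∀ a : Config m, (∀ J, r < J.card → coeff a J = 0) → f a = g a) :
    LogicallyEquiv (code m q r) (Matrix.diagonal f) (Matrix.diagonal g) := by
  intro ψ hψ
  funext a
  rw [Matrix.mulVec_diagonal, Matrix.mulVec_diagonal]
  by_cases ha : ψ a = 0
  · rw [ha, mul_zero, mul_zero]
  · rw [h a fun J hJ => coeff_eq_zero_of_mem_code hψ ha hJ]

end QRM

theorem mainTheorem6 (m r k : ℕ) (hrm : r ≤ m) (K : Finset (Fin m)) :
    (2 ≤ r → K.card = k * r + 1 →
      QRM.LogicallyEquiv (QRM.code m 0 r)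
        (QRM.subcubeOp (QRM.zGate k) (QRM.standardCube K))
        (QRM.controlledZCircuit (QRM.minimalCovers 0 r K) * QRM.facetCircuit 0 r K)) ∧
    (∀ q : ℕ, q ≤ r → K ∈ QRM.levelIndex m q r k →
      ¬ QRM.LogicallyEquiv (QRM.code m q r)
        (QRM.subcubeOp (QRM.zGate k) (QRM.standardCube K))
        (QRM.signedOp k (QRM.standardCube K)) →
      q = 0 ∧ K.card = k * r + 1) := by
  constructor
  · intro hr hK
    rw [QRM.subcubeOp_zGate, QRM.controlledZCircuit_minimalCovers, QRM.facetCircuit_eq,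
      Matrix.diagonal_mul_diagonal]
    refine QRM.logicallyEquiv_diagonal fun a ha => ?_
    rw [QRM.phase_zpow_eq (QRM.weight_modEq hr hK ha), QRM.phase_zpow_mul, pow_add]
  · intro q _ hK hne
    simp only [QRM.levelIndex, Finset.mem_filter, Finset.mem_univ, true_and] at hK
    by_contra hcon
    refine hne ?_
    have hr : 1 ≤ r := by
      rcases Nat.eq_zero_or_pos r with rfl | h
      · omega
      · exact h
    rw [QRM.subcubeOp_zGate, QRM.signedOp_standardCube]
    refine QRM.logicallyEquiv_diagonal fun a ha => QRM.phase_zpow_eq (Int.ModEq.symm ?_)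
    rw [Int.modEq_iff_dvd, ← Finset.sum_sub_distrib]
    -- Since |K| ≥ q + kr + 1, failure of the conclusion means |K| > kr + 1. The difference 1 - (±1)
    -- is twice the indicator of odd cardinality.
    have hdvd := QRM.dvd_two_mul_odd_weight (k := k) hr (by omega) ha (K := K)
    rw [Finset.mul_sum] at hdvd
    convert hdvd using 2
    split_ifs <;> ring
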